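/- For every integer $s \ge 2$ there is a constant $C = C(s)$ such that the following holds for every sufficiently large real number $d$ (that is, for all $d \ge d_0$ with $d_0 = d_0(s)$). Let $G$ be a finite simple graph on $n$ vertices whose average degree $2|E(G)|/n$ is at least $d$, where $d \le n^{\frac{s-1}{s}}$. Then there is a non-empty set $R \subseteq V(G)$ of size at most $n\, d^{-\frac{s}{s-1}} (\log d)^{C}$ such that the induced subgraph $G[R]$ has minimum degree at least $s$. -/

import Mathlib

/-- The average degree of a finite graph: the mean of its vertex degrees
(equivalently, twice the number of edges divided by the number of vertices). -/
noncomputable def SimpleGraph.avgDegree {V : Type*} [Fintype V] (G : SimpleGraph V)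
    [DecidableRel G.Adj] : ℝ :=
  (∑ v : V, (G.degree v : ℝ)) / (Fintype.card V : ℝ)

/-!
Random sampling followed by a peeling argument gives the bound, with `C = 1`.

A set `W` whose induced subgraph has minimum degree at least `d / 2` exists
(`exists_nonempty_forall_half_le_card_adj`). Sample about `m * d ^ (-s / (s - 1))` vertices of `W`,
where `m = |W|`, up to a large constant factor. A vertex of `W` then sees about `d ^ (-1 / (s - 1))`
samples on average, so of the order of `m * d ^ (-s / (s - 1))` vertices see at least `s` of them.
The number of samples is linear in the constant factor, the number of these vertices grows as its
`s`-th power, so for a suitable constant there is a sample `A` and a set `B` of vertices with `s`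
neighbours in `A` each, such that `|B| > s * |A|` (`exists_card_le_many_adj` and
`sq_mul_lt_card_mul_pow`).

Successively deleting vertices of `A` with fewer than `s` neighbours in `B`, along with those
neighbours, costs fewer than `|B|` vertices of `B`. What is left is nonempty and has minimum degree
at least `s` (`exists_subset_forall_le_card_adj`). Its size is at most a constant times
`m * d ^ (-s / (s - 1))`, or just a constant if this is below `1`; the upper bound on `d` and the
factor `log d` absorb these.
-/

open Finset

/-- A finite graph contains a nonempty vertex set in which every vertex has at least half of the
average degree as its number of neighbours. The set is chosen to maximise
`∑ v ∈ W, deg_W v - d * |W|`. -/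
theorem exists_nonempty_forall_half_le_card_adj {V : Type*} [Fintype V] (G : SimpleGraph V)
    [DecidableRel G.Adj] {d : ℝ} (hd : 0 < d) (h : d ≤ G.avgDegree) :
    ∃ W : Finset V, W.Nonempty ∧ ∀ v ∈ W, d / 2 ≤ (#{u ∈ W | G.Adj v u} : ℝ) := by
  classical
  have hV : (0 : ℝ) < Fintype.card V := by
    rcases Nat.eq_zero_or_pos (Fintype.card V) with h0 | h0
    · rw [SimpleGraph.avgDegree, h0] at h
      simp at h
      linarith
    · exact_mod_cast h0
  have : Nonempty V := Fintype.card_pos_iff.mp (by exact_mod_cast hV)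
  let f : Finset V → ℝ := fun W => ∑ v ∈ W, ∑ u ∈ W, (if G.Adj v u then (1 : ℝ) else 0) - d * #W
  obtain ⟨W, hW, hmax⟩ := exists_max_image ({W | W.Nonempty} : Finset (Finset V)) f
    ⟨univ, by simp⟩
  simp only [mem_filter, mem_univ, true_and] at hW hmax
  have huniv : 0 ≤ f univ := by
    have h1 : d * Fintype.card V ≤ ∑ v : V, (G.degree v : ℝ) := by
      rw [SimpleGraph.avgDegree, le_div_iff₀ hV] at h
      exact h
    have h2 : ∀ v, (G.degree v : ℝ) = ∑ u, if G.Adj v u then (1 : ℝ) else 0 := by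
      intro v
      rw [sum_boole, ← SimpleGraph.card_neighborFinset_eq_degree, G.neighborFinset_eq_filter]
    simp only [f, card_univ, ← h2]
    linarith
  have hfW : 0 ≤ f W := huniv.trans (hmax _ univ_nonempty)
  refine ⟨W, hW, fun v hv => ?_⟩
  have hins : insert v (W.erase v) = W := insert_erase hv
  have hne : (W.erase v).Nonempty := by
    rw [nonempty_iff_ne_empty]
    intro h0
    rw [h0] at hins
    rw [← hins] at hfW
    simp only [f, insert_empty_eq, sum_singleton, SimpleGraph.irrefl, if_false, card_singleton] at hfW
    norm_num at hfW
    linarith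
  have hdeg : (#{u ∈ W | G.Adj v u} : ℝ) =
      ∑ u ∈ W.erase v, if G.Adj v u then (1 : ℝ) else 0 := by
    rw [← sum_boole]
    conv_lhs => rw [← hins]
    rw [sum_insert (notMem_erase v W)]
    simp
  have hstep : f W = f (W.erase v) + 2 * #{u ∈ W | G.Adj v u} - d := by
    rw [hdeg]
    conv_lhs => rw [← hins]
    simp only [f]
    simp only [sum_insert (notMem_erase v W), card_insert_of_notMem (notMem_erase v W),
      sum_add_distrib, SimpleGraph.irrefl, if_false]
    simp only [G.adj_comm _ v]
    push_cast
    ring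
  have := hmax _ hne
  linarith

/-- The number of `k`-tuples in `W` that meet a subset `P` of `W`. -/
theorem card_filter_piFinset_exists_mem {V : Type*} [DecidableEq V] {W P : Finset V} (hP : P ⊆ W)
    (k : ℕ) :
    (#{g ∈ Fintype.piFinset (fun _ : Fin k => W) | ∃ j, g j ∈ P} : ℝ) =
      (#W : ℝ) ^ k - ((#W : ℝ) - #P) ^ k := by
  have h1 : {g ∈ Fintype.piFinset (fun _ : Fin k => W) | ¬ ∃ j, g j ∈ P} =
      Fintype.piFinset (fun _ : Fin k => W \ P) := by
    ext g
    simp [Fintype.mem_piFinset, forall_and]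
  have h2 := card_filter_add_card_filter_not (s := Fintype.piFinset (fun _ : Fin k => W))
    (fun g => ∃ j, g j ∈ P)
  rw [h1] at h2
  simp only [Fintype.card_piFinset_const] at h2
  have h3 : ((#(W \ P) : ℕ) : ℝ) = (#W : ℝ) - #P := by
    rw [card_sdiff_of_subset hP, Nat.cast_sub (card_le_card hP)]
  rw [← h3, eq_sub_iff_add_eq]
  exact_mod_cast h2

/-- Sampling: if every `v ∈ W` has at least `s * t` neighbours in `W`, then some set of at most
`s * k` vertices provides `s` neighbours for a proportion `(1 - (1 - t / |W|) ^ k) ^ s` of `W`.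
The `s * k` vertices are drawn independently in `s` blocks; `v` is counted only when, for each `i`,
the `i`-th block meets the `i`-th of `s` disjoint `t`-subsets of the neighbourhood of `v`. -/
theorem exists_card_le_many_adj {V : Type*} [DecidableEq V] (G : SimpleGraph V)
    [DecidableRel G.Adj] {W : Finset V} (hW : W.Nonempty) (s t k : ℕ)
    (h : ∀ v ∈ W, s * t ≤ #{u ∈ W | G.Adj v u}) :
    ∃ A : Finset V, #A ≤ s * k ∧
      (#W : ℝ) * (1 - (1 - (t : ℝ) / #W) ^ k) ^ s ≤
        (#{v ∈ W | s ≤ #{u ∈ A | G.Adj v u}} : ℝ) := by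
  have hn : (0 : ℝ) < #W := by exact_mod_cast hW.card_pos
  have hparts : ∀ v, ∃ P : Fin s → Finset V, v ∈ W →
      (∀ i, P i ⊆ {u ∈ W | G.Adj v u} ∧ #(P i) = t) ∧
      ∀ i j, i ≠ j → Disjoint (P i) (P j) := by
    intro v
    by_cases hv : v ∈ W
    swap
    · exact ⟨fun _ => ∅, fun h => absurd h hv⟩
    obtain ⟨e⟩ : Nonempty (Fin s × Fin t ↪ {u // u ∈ ({u ∈ W | G.Adj v u} : Finset V)}) := by
      apply Function.Embedding.nonempty_of_card_le
      simpa using h v hv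
    have hinj : Function.Injective fun p => (e p : V) := Subtype.val_injective.comp e.injective
    refine ⟨fun i => univ.image fun j => (e (i, j) : V), fun _ => ⟨fun i => ⟨?_, ?_⟩, ?_⟩⟩
    · intro u hu
      obtain ⟨j, -, rfl⟩ := mem_image.mp hu
      exact (e (i, j)).2
    · rw [card_image_of_injective _ (fun a b hab => ?_)]
      · simp
      · simpa using hinj hab
    · intro i j hij
      rw [disjoint_left]
      intro u hu hu'
      obtain ⟨a, -, rfl⟩ := mem_image.mp hu
      obtain ⟨b, -, hb⟩ := mem_image.mp hu'
      have := hinj hb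
      simp only [Prod.mk.injEq] at this
      exact hij this.1.symm
  choose P hP using hparts
  let Ω := Fintype.piFinset fun _ : Fin s => Fintype.piFinset fun _ : Fin k => W
  have hΩ : (#Ω : ℝ) = ((#W : ℝ) ^ k) ^ s := by
    simp [Ω]
  have hΩne : Ω.Nonempty := by
    rw [← card_pos]
    have : (0 : ℝ) < #Ω := by rw [hΩ]; positivity
    exact_mod_cast this
  let good : V → (Fin s → Fin k → V) → Prop := fun v f => ∀ i, ∃ j, f i j ∈ P v i
  have hcount : ∀ v ∈ W,
      (#{f ∈ Ω | good v f} : ℝ) = #Ω * (1 - (1 - (t : ℝ) / #W) ^ k) ^ s := by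
    intro v hv
    have h1 : {f ∈ Ω | good v f} = Fintype.piFinset fun i : Fin s =>
        {g ∈ Fintype.piFinset (fun _ : Fin k => W) | ∃ j, g j ∈ P v i} := by
      ext f
      simp only [Ω, good, mem_filter, Fintype.mem_piFinset, ← forall_and]
    rw [h1, Fintype.card_piFinset, Nat.cast_prod]
    have h2 : ∀ i : Fin s,
        (#{g ∈ Fintype.piFinset (fun _ : Fin k => W) | ∃ j, g j ∈ P v i} : ℝ) =
          (#W : ℝ) ^ k * (1 - (1 - (t : ℝ) / #W) ^ k) := by
      intro i
      rw [card_filter_piFinset_exists_mem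
        (((hP v hv).1 i).1.trans (filter_subset _ _)), ((hP v hv).1 i).2, mul_sub, mul_one,
        ← mul_pow]
      congr 2
      field_simp
    rw [prod_congr rfl fun i _ => h2 i]
    simp [hΩ, mul_pow]
  have hadj : ∀ v ∈ W, ∀ f, good v f →
      s ≤ #{u ∈ univ.image (fun p : Fin s × Fin k => f p.1 p.2) | G.Adj v u} := by
    intro v hv f hf
    choose j hj using hf
    calc s = #(univ.image fun i => f i (j i)) := by
          rw [card_image_of_injective _ (fun a b hab => ?_)]
          · simp
          · by_contra hne
            have hab' : f a (j a) = f b (j b) := hab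
            exact disjoint_left.mp ((hP v hv).2 a b hne) (hj a) (hab' ▸ hj b)
      _ ≤ _ := by
          apply card_le_card
          intro u hu
          obtain ⟨i, -, rfl⟩ := mem_image.mp hu
          exact mem_filter.mpr ⟨mem_image.mpr ⟨(i, j i), mem_univ _, rfl⟩,
            (mem_filter.mp (((hP v hv).1 i).1 (hj i))).2⟩
  have hsum : ∑ _f ∈ Ω, (#W : ℝ) * (1 - (1 - (t : ℝ) / #W) ^ k) ^ s ≤
      ∑ f ∈ Ω, (#{v ∈ W | good v f} : ℝ) := by
    have := sum_card_bipartiteAbove_eq_sum_card_bipartiteBelow (s := W) (t := Ω) good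
    simp only [bipartiteAbove, bipartiteBelow] at this
    rw [← Nat.cast_sum, ← this, Nat.cast_sum, sum_congr rfl hcount]
    simp only [sum_const, nsmul_eq_mul]
    apply le_of_eq
    ring
  obtain ⟨f, -, hf⟩ := exists_le_of_sum_le hΩne hsum
  refine ⟨univ.image fun p : Fin s × Fin k => f p.1 p.2, ?_, hf.trans ?_⟩
  · exact card_image_le.trans (by simp)
  · exact_mod_cast card_le_card fun v hv => by
      rw [mem_filter] at hv ⊢
      exact ⟨hv.1, hadj v hv.1 f hv.2⟩

/-- Peeling: if `|B| > s * |A|` and every vertex of `B` has `s` neighbours in `A`, then `A ∪ B`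
contains a nonempty set of minimum degree at least `s`. A vertex of `A` with fewer than `s`
neighbours in `B` is removed together with all of these; the hypotheses survive. -/
theorem exists_subset_forall_le_card_adj {V : Type*} [DecidableEq V] (G : SimpleGraph V)
    [DecidableRel G.Adj] (s : ℕ) (A B : Finset V) (hAB : s * #A < #B)
    (hB : ∀ b ∈ B, s ≤ #{a ∈ A | G.Adj b a}) :
    ∃ R ⊆ A ∪ B, R.Nonempty ∧ ∀ v ∈ R, s ≤ #{u ∈ R | G.Adj v u} := by
  induction A using Finset.strongInduction generalizing B with
  | H A ih =>
    by_cases hA : ∀ a ∈ A, s ≤ #{b ∈ B | G.Adj a b}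
    · refine ⟨A ∪ B, Subset.rfl, ?_, fun v hv => ?_⟩
      · exact (card_pos.mp (by omega : 0 < #B)).mono subset_union_right
      · rcases mem_union.mp hv with hv | hv
        · exact (hA v hv).trans (card_le_card (filter_subset_filter _ subset_union_right))
        · exact (hB v hv).trans (card_le_card (filter_subset_filter _ subset_union_left))
    · push Not at hA
      obtain ⟨a, ha, hlt⟩ := hA
      obtain ⟨R, hR, hne, hdeg⟩ := ih (A.erase a) (erase_ssubset ha) {b ∈ B | ¬ G.Adj a b} (by
        have h1 := card_filter_add_card_filter_not (s := B) fun b => G.Adj a b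
        have h2 : s * #A = s * #(A.erase a) + s := by
          rw [← card_erase_add_one ha]; ring
        omega) (by
        intro b hb
        rw [mem_filter] at hb
        refine (hB b hb.1).trans (card_le_card fun u hu => ?_)
        rw [mem_filter] at hu ⊢
        refine ⟨mem_erase.mpr ⟨?_, hu.1⟩, hu.2⟩
        rintro rfl
        exact hb.2 hu.2.symm)
      exact ⟨R, hR.trans (union_subset_union (erase_subset _ _) (filter_subset _ _)), hne, hdeg⟩

/-- The bound `1 - (1 - δ) ^ k ≥ min 1 (k δ) / 2`, a consequence of Bernoulli's inequality. -/
theorem min_div_two_le_one_sub_pow {δ : ℝ} (h0 : 0 ≤ δ) (h1 : δ ≤ 1) (k : ℕ) :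
    min 1 (k * δ) / 2 ≤ 1 - (1 - δ) ^ k := by
  have hx : 0 ≤ k * δ := by positivity
  have h2 : 1 + k * δ ≤ (1 + δ) ^ k := one_add_mul_le_pow (by linarith) k
  have h3 : 0 ≤ (1 - δ) ^ k := pow_nonneg (by linarith) k
  have h4 : (1 - δ) ^ k * (1 + δ) ^ k ≤ 1 := by
    rw [← mul_pow]
    exact pow_le_one₀ (by nlinarith) (by nlinarith)
  have h5 : (1 - δ) ^ k * (1 + k * δ) ≤ 1 := (mul_le_mul_of_nonneg_left h2 h3).trans h4
  rcases le_total 1 (k * δ) with h | h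
  · rw [min_eq_left h]
    nlinarith
  · rw [min_eq_right h]
    nlinarith

/-- With `k ≈ K * max 1 (m * d ^ (-s / (s - 1)))` samples per block, more than `s ^ 2 * k` vertices
of an `m`-vertex graph of minimum degree at least `d / 2` are expected to see `s` samples. -/
theorem sq_mul_lt_card_mul_pow {s m k : ℕ} {d K δ : ℝ} (hs : 2 ≤ s)
    (hK : K = (8 * s : ℝ) ^ s * s ^ 2 + 1) (hd : 4 * K * s ^ 2 * 2 ^ s < d)
    (hm : d / 2 ≤ m) (hδ : d / (4 * s * m) ≤ δ) (hδ1 : δ ≤ 1)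
    (hk : K * max 1 (m * d ^ (-((s : ℝ) / (s - 1)))) ≤ k)
    (hk' : k ≤ 2 * (K * max 1 (m * d ^ (-((s : ℝ) / (s - 1)))))) :
    (s : ℝ) ^ 2 * k < m * (1 - (1 - δ) ^ k) ^ s := by
  have hs' : (2 : ℝ) ≤ s := by exact_mod_cast hs
  have hK1 : 1 ≤ K := by rw [hK]; linarith [show (0 : ℝ) ≤ (8 * s : ℝ) ^ s * s ^ 2 by positivity]
  have hd1 : 1 ≤ d := by
    have : (1 : ℝ) ≤ 2 ^ s := one_le_pow₀ (by norm_num)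
    nlinarith [mul_le_mul hK1 this (by norm_num) (by linarith)]
  have hd0 : 0 < d := by linarith
  have hm0 : (0 : ℝ) < m := by linarith
  have hδ0 : 0 ≤ δ := le_trans (by positivity) hδ
  set q := max 1 (m * d ^ (-((s : ℝ) / (s - 1)))) with hq
  have hq1 : 1 ≤ q := le_max_left _ _
  have hk0 : (0 : ℝ) < k := by nlinarith
  have hb := min_div_two_le_one_sub_pow hδ0 hδ1 k
  rcases le_total 1 (k * δ) with h | h
  -- Each vertex sees `s` samples with probability at least `2 ^ (-s)`, and `k` is small next to `m`.
  · rw [min_eq_left h] at hb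
    have hqm : q ≤ 2 * m / d := by
      apply max_le
      · rw [le_div_iff₀ hd0]; linarith
      · have : d ^ (-((s : ℝ) / (s - 1))) ≤ d ^ (-1 : ℝ) := by
          apply Real.rpow_le_rpow_of_exponent_le hd1
          rw [neg_le_neg_iff, le_div_iff₀ (by linarith)]
          linarith
        rw [Real.rpow_neg_one] at this
        calc _ ≤ (m : ℝ) * d⁻¹ := by gcongr
          _ ≤ 2 * m / d := by
            rw [← div_eq_mul_inv]
            gcongr
            linarith
    calc (s : ℝ) ^ 2 * k ≤ s ^ 2 * (2 * (K * (2 * m / d))) := by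
          gcongr
          refine hk'.trans ?_
          gcongr
      _ = m * (4 * K * s ^ 2) / d := by ring
      _ < m * (1 / 2) ^ s := by
          rw [mul_div_assoc]
          gcongr
          rw [one_div_pow, div_lt_div_iff₀ hd0 (by positivity), one_mul]
          exact hd
      _ ≤ _ := by gcongr
  -- Here `(k δ / 2) ^ s * m ≥ k * (k ^ (s - 1) * d ^ s / m ^ (s - 1)) / (8 * s) ^ s`, and the lower
  -- bound on `k` makes the bracket at least `K ^ (s - 1) ≥ K`.
  · rw [min_eq_right h] at hb
    have hkq : K * (m * d ^ (-((s : ℝ) / (s - 1)))) ≤ k :=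
      le_trans (by gcongr; exact le_max_right _ _) hk
    obtain ⟨r, rfl⟩ : ∃ r, s = r + 1 := ⟨s - 1, by omega⟩
    have hpow : (d ^ (-(((r + 1 : ℕ) : ℝ) / (((r + 1 : ℕ) : ℝ) - 1)))) ^ r * d ^ (r + 1) = 1 := by
      have hr : (r : ℝ) ≠ 0 := by
        have : r ≠ 0 := by omega
        exact_mod_cast this
      rw [← Real.rpow_natCast, ← Real.rpow_mul hd0.le, ← Real.rpow_natCast d (r + 1),
        ← Real.rpow_add hd0]
      have : -(((r + 1 : ℕ) : ℝ) / (((r + 1 : ℕ) : ℝ) - 1)) * r + ((r + 1 : ℕ) : ℝ) = 0 := by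
        push_cast
        rw [add_sub_cancel_right, neg_mul, div_mul_cancel₀ _ hr, neg_add_cancel]
      rw [this, Real.rpow_zero]
    set y := d ^ (-(((r + 1 : ℕ) : ℝ) / (((r + 1 : ℕ) : ℝ) - 1))) with hy
    have hy0 : 0 < y := Real.rpow_pos_of_pos hd0 _
    set S : ℝ := ((r + 1 : ℕ) : ℝ) with hS
    have hKr : K ≤ K ^ r := le_self_pow₀ hK1 (by omega)
    have hkr : K * m ^ r ≤ k ^ r * d ^ (r + 1) := by
      calc K * m ^ r ≤ K ^ r * m ^ r := by gcongr
        _ = (K * (m * y)) ^ r * d ^ (r + 1) := by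
          rw [mul_pow, mul_pow, mul_assoc, mul_assoc, hpow, mul_one]
        _ ≤ _ := by gcongr
    calc S ^ 2 * k = (S ^ 2 * (8 * S) ^ (r + 1)) * k / (8 * S) ^ (r + 1) := by
          field_simp
      _ < K * k / (8 * S) ^ (r + 1) := by
          gcongr
          rw [hK]
          linarith
      _ = (K * m ^ r) * k / (m ^ r * (8 * S) ^ (r + 1)) := by
          field_simp
      _ ≤ (k ^ r * d ^ (r + 1)) * k / (m ^ r * (8 * S) ^ (r + 1)) := by gcongr
      _ = m * (k * (d / (4 * S * m)) / 2) ^ (r + 1) := by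
          have : k * (d / (4 * S * m)) / 2 = k * d / (8 * S * m) := by
            field_simp
            norm_num
          rw [this, div_pow, mul_pow (k : ℝ) d, mul_pow (8 * S), pow_succ (m : ℝ) r,
            pow_succ (k : ℝ) r]
          field_simp
      _ ≤ m * (k * δ / 2) ^ (r + 1) := by gcongr
      _ ≤ _ := by gcongr

/-- A lower bound on the number of neighbours inside `R` of each vertex of `R` bounds the minimum
degree of the induced subgraph. -/
theorem le_minDegree_induce_of_forall {V : Type*} [Fintype V] (G : SimpleGraph V)
    [DecidableRel G.Adj] {R : Finset V} (hR : R.Nonempty) {s : ℕ}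
    (h : ∀ v ∈ R, s ≤ #{u ∈ R | G.Adj v u}) :
    s ≤ (G.induce (R : Set V)).minDegree := by
  classical
  have : Nonempty (R : Set V) := hR.to_subtype
  apply SimpleGraph.le_minDegree_of_forall_le_degree
  rintro ⟨v, hv⟩
  refine (h v hv).trans ?_
  rw [← SimpleGraph.card_neighborFinset_eq_degree,
    ← card_map (Function.Embedding.subtype (· ∈ (R : Set V)))]
  apply card_le_card
  intro u hu
  rw [mem_filter] at hu
  exact mem_map.mpr ⟨⟨u, hu.1⟩, by simpa using hu.2, rfl⟩

theorem mainTheorem3 (s : ℕ) (hs : 2 ≤ s) :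
    ∃ C : ℝ, ∃ d₀ : ℝ, ∀ d : ℝ, d₀ ≤ d →
      ∀ (V : Type*) [Fintype V] (G : SimpleGraph V) [DecidableRel G.Adj],
        d ≤ G.avgDegree →
        d ≤ (Fintype.card V : ℝ) ^ (((s : ℝ) - 1) / (s : ℝ)) →
        ∃ R : Finset V, R.Nonempty ∧
          (R.card : ℝ) ≤
            (Fintype.card V : ℝ) * d ^ (-((s : ℝ) / ((s : ℝ) - 1))) * Real.log d ^ C ∧
          s ≤ (G.induce (R : Set V)).minDegree := by
  classical
  set K : ℝ := (8 * s : ℝ) ^ s * s ^ 2 + 1 with hK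
  have hs' : (2 : ℝ) ≤ s := by exact_mod_cast hs
  have hK1 : 1 ≤ K := by rw [hK]; linarith [show (0 : ℝ) ≤ (8 * s : ℝ) ^ s * s ^ 2 by positivity]
  -- `log d` has to exceed the constant `6 * s ^ 2 * K` lost by the construction; the second summand
  -- is the threshold in `sq_mul_lt_card_mul_pow`, the third makes `⌊d / (2 * s)⌋ ≥ d / (4 * s)`.
  refine ⟨1, Real.exp (6 * s ^ 2 * K) + 4 * K * s ^ 2 * 2 ^ s + 4 * s, ?_⟩
  intro d hd V _ G _ havg hdn
  have hexp := Real.exp_pos (6 * s ^ 2 * K)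
  have hpos : 0 ≤ 4 * K * s ^ 2 * 2 ^ s := by positivity
  have hd0 : 0 < d := by linarith
  have hlog : 6 * s ^ 2 * K ≤ Real.log d := by
    rw [Real.le_log_iff_exp_le hd0]
    linarith
  obtain ⟨W, hW, hdeg⟩ := exists_nonempty_forall_half_le_card_adj G hd0 havg
  have hW0 : (0 : ℝ) < #W := by exact_mod_cast hW.card_pos
  have hWV : (#W : ℝ) ≤ Fintype.card V := by exact_mod_cast card_le_univ W
  have hcard : (0 : ℝ) < Fintype.card V := hW0.trans_le hWV
  obtain ⟨v₀, hv₀⟩ := hW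
  have hm : d / 2 ≤ #W :=
    (hdeg v₀ hv₀).trans (by exact_mod_cast card_le_card (filter_subset _ _))
  set q := max 1 ((#W : ℝ) * d ^ (-((s : ℝ) / (s - 1)))) with hq
  have hq1 : 1 ≤ q := le_max_left _ _
  have hKq : 1 ≤ K * q := one_le_mul_of_one_le_of_one_le hK1 hq1
  set k := ⌈K * q⌉₊ with hk
  have hk1 : K * q ≤ k := Nat.le_ceil _
  have hk2 : (k : ℝ) ≤ 2 * (K * q) := by
    have := Nat.ceil_lt_add_one (show 0 ≤ K * q by linarith)
    rw [← hk] at this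
    linarith
  set t := ⌊d / 2 / s⌋₊ with ht
  have hs0 : (0 : ℝ) < s := by linarith
  have ht1 : (s : ℝ) * t ≤ d / 2 := by
    have := Nat.floor_le (show 0 ≤ d / 2 / s by positivity)
    rwa [← ht, le_div_iff₀ hs0, mul_comm] at this
  have ht2 : d / (4 * s) ≤ t := by
    have h1 := Nat.lt_floor_add_one (d / 2 / s)
    rw [← ht] at h1
    have h2 : 1 ≤ d / (4 * s) := by
      rw [le_div_iff₀ (by positivity)]
      linarith
    have h3 : d / 2 / s = 2 * (d / (4 * s)) := by
      field_simp
      norm_num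
    linarith
  have htW : (t : ℝ) ≤ #W := by
    have : (0 : ℝ) ≤ t := Nat.cast_nonneg t
    nlinarith
  obtain ⟨A, hA, hAcount⟩ := exists_card_le_many_adj G ⟨v₀, hv₀⟩ s t k fun v hv => by
    have := ht1.trans (hdeg v hv)
    exact_mod_cast this
  have hmany := sq_mul_lt_card_mul_pow (k := k) (δ := (t : ℝ) / #W) hs hK (by linarith) hm
    (by rw [← div_div]; gcongr) (by rw [div_le_one hW0]; exact htW) hk1 hk2
  have hlt : s * #A + 1 ≤ #{v ∈ W | s ≤ #{u ∈ A | G.Adj v u}} := by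
    have h1 : s ^ 2 * k < #{v ∈ W | s ≤ #{u ∈ A | G.Adj v u}} := by
      exact_mod_cast hmany.trans_le hAcount
    have h2 : s * #A ≤ s ^ 2 * k := by
      rw [sq, mul_assoc]
      exact Nat.mul_le_mul_left s hA
    omega
  obtain ⟨B, hBsub, hBcard⟩ := exists_subset_card_eq hlt
  obtain ⟨R, hRsub, hRne, hRdeg⟩ := exists_subset_forall_le_card_adj G s A B (by omega)
    fun b hb => (mem_filter.mp (hBsub hb)).2
  refine ⟨R, hRne, ?_, le_minDegree_induce_of_forall G hRne hRdeg⟩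
  have hRcard : #R ≤ s * k + (s * (s * k) + 1) := by
    calc #R ≤ #A + #B := (card_le_card hRsub).trans (card_union_le _ _)
      _ ≤ _ := by
        rw [hBcard]
        gcongr
  have hRcard' : (#R : ℝ) ≤ 3 * s ^ 2 * k := by
    have h1 : (#R : ℝ) ≤ s * k + (s * (s * k) + 1) := by exact_mod_cast hRcard
    have h2 : (1 : ℝ) ≤ k := hKq.trans hk1
    have h3 : (1 : ℝ) ≤ s * k := by nlinarith
    nlinarith
  -- The hypothesis `d ≤ n ^ ((s - 1) / s)` says exactly that the target size is at least `1`.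
  have hone : 1 ≤ (Fintype.card V : ℝ) * d ^ (-((s : ℝ) / (s - 1))) := by
    have h1 : d ^ ((s : ℝ) / (s - 1)) ≤ Fintype.card V := by
      calc d ^ ((s : ℝ) / (s - 1))
          ≤ ((Fintype.card V : ℝ) ^ (((s : ℝ) - 1) / s)) ^ ((s : ℝ) / (s - 1)) :=
            Real.rpow_le_rpow hd0.le hdn (div_nonneg hs0.le (by linarith))
        _ = Fintype.card V := by
          rw [← Real.rpow_mul hcard.le]
          have h2 : (s : ℝ) - 1 ≠ 0 := by linarith
          have : ((s : ℝ) - 1) / s * (s / (s - 1)) = 1 := by field_simp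
          rw [this, Real.rpow_one]
    rw [Real.rpow_neg hd0.le, ← div_eq_mul_inv, one_le_div (Real.rpow_pos_of_pos hd0 _)]
    exact h1
  have hqle : q ≤ (Fintype.card V : ℝ) * d ^ (-((s : ℝ) / (s - 1))) := by
    apply max_le hone
    gcongr
  rw [Real.rpow_one]
  calc (#R : ℝ) ≤ 3 * s ^ 2 * (2 * (K * q)) := hRcard'.trans (by gcongr)
    _ = q * (6 * s ^ 2 * K) := by ring
    _ ≤ _ := by gcongr
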